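/- Let $G$ be a group and let $\mathcal{F}$ be a family of finite subgroups of $G$ that is closed under conjugation and under taking subgroups. Let $R$ be $\mathbb{Z}$, or, for a prime $q$, the field $\mathbb{F}_q$ or the localization $\mathbb{Z}_{(q)}$ of $\mathbb{Z}$ at $q$. If $R=\mathbb{F}_q$ or $R=\mathbb{Z}_{(q)}$, let $\mathcal{P}\subseteq\mathcal{F}$ be the subfamily of all $q$-subgroups in $\mathcal{F}$; if $R=\mathbb{Z}$, let $\mathcal{P}\subseteq\mathcal{F}$ be the subfamily of all subgroups in $\mathcal{F}$ that are $p$-groups for some prime $p$. For a family $\mathcal{X}$ of finite subgroups closed under conjugation and subgroups, let $\mathcal{H}_{\mathcal{X}}$ be the Hecke category: its objects are the transitive $G$-sets $G/H$ with $H\in\mathcal{X}$, and its morphisms $G/H\to G/K$ are the $RG$-module homomorphisms $R[G/H]\to R[G/K]$. An $\mathcal{H}_{\mathcal{X}}$-module is a contravariant $R$-linear functor from $\mathcal{H}_{\mathcal{X}}$ to $R$-modules, and exactness of sequences of such modules is objectwise. The free modules are the direct sums of representable modules $R[-,G/H]_{\mathcal{H}_{\mathcal{X}}}$, the projective modules are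 their direct summands, and a module is finitely generated if it is a quotient of a finite direct sum of representables. Let $R^-$ be the fixed point functor of the trivial $RG$-module $R$, that is, $R^-(G/H)=\operatorname{Hom}_{RG}(R[G/H],R)\cong R^H$. The dimension $\mathcal{H}_{\mathcal{X}}\mathrm{cd}\,G\in\mathbb{N}\cup\{\infty\}$ is the length of the shortest projective resolution of $R^-$ by $\mathcal{H}_{\mathcal{X}}$-modules ($\infty$ if there is none of finite length), and $G$ is $\mathcal{H}_{\mathcal{X}}\mathrm{FP}_n$ if $R^-$ has a projective resolution by $\mathcal{H}_{\mathcal{X}}$-modules that is finitely generated in all degrees $\le n$ (in all degrees if $n=\infty$). Then for every $n\in\mathbb{N}\cup\{\infty\}$: $$\mathcal{H}_{\mathcal{F}}\mathrm{cd}\,G=n \iff \mathcal{H}_{\mathcal{P}}\mathrm{cd}\,G=n,$$ and $G$ is $\mathcal{H}_{\mathcal{F}}\mathrm{FP}_n$ if and only if $G$ is $\mathcal{H}_{\mathcal{P}}\mathrm{FP}_n$. -/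

import Mathlib

open CategoryTheory CategoryTheory.Limits Opposite

universe w u

/-- A family of finite subgroups of `G`, closed under conjugation and under taking subgroups. -/
structure FiniteSubgroupFamily (G : Type u) [Group G] where
  carrier : Set (Subgroup G)
  finite_mem : ∀ H ∈ carrier, Finite H
  subgroup_mem : ∀ H ∈ carrier, ∀ K : Subgroup G, K ≤ H → K ∈ carrier
  conj_mem : ∀ H ∈ carrier, ∀ g : G, H.map (MulAut.conj g).toMonoidHom ∈ carrier

namespace FiniteSubgroupFamily

variable {G : Type u} [Group G]

/-- The subfamily of all `q`-subgroups (subgroups of order a power of `q`) in a family. -/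
def pSubgroups (F : FiniteSubgroupFamily G) (q : ℕ) : FiniteSubgroupFamily G where
  carrier := {H | H ∈ F.carrier ∧ IsPGroup q H}
  finite_mem H hH := F.finite_mem H hH.1
  subgroup_mem H hH K hK := ⟨F.subgroup_mem H hH.1 K hK, hH.2.to_le hK⟩
  conj_mem H hH g := ⟨F.conj_mem H hH.1 g, hH.2.map _⟩

/-- The subfamily of all subgroups of prime power order in a family: the union over all primes `p`
of the `p`-subgroups. -/
def primePowerSubgroups (F : FiniteSubgroupFamily G) : FiniteSubgroupFamily G where
  carrier := {H | H ∈ F.carrier ∧ ∃ p : ℕ, p.Prime ∧ IsPGroup p H}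
  finite_mem H hH := F.finite_mem H hH.1
  subgroup_mem H hH K hK := ⟨F.subgroup_mem H hH.1 K hK, by
    obtain ⟨p, hp, h⟩ := hH.2
    exact ⟨p, hp, h.to_le hK⟩⟩
  conj_mem H hH g := ⟨F.conj_mem H hH.1 g, by
    obtain ⟨p, hp, h⟩ := hH.2
    exact ⟨p, hp, h.map _⟩⟩

end FiniteSubgroupFamily

noncomputable section

variable {G : Type u} [Group G]

/-- The permutation module `R[G/H]`. -/
abbrev permutationModule (R : Type w) [CommRing R] (H : Subgroup G) : Rep.{max u w} R G :=
  Rep.ofMulAction R G (G ⧸ H)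

/-- The Hecke category `𝓗_F`: its objects are the transitive `G`-sets `G/H` with `H ∈ F`, and its
morphisms `G/H ⟶ G/K` are the `RG`-module homomorphisms `R[G/H] → R[G/K]`. -/
abbrev HeckeCategory (R : Type w) [CommRing R] (F : FiniteSubgroupFamily G) : Type u :=
  InducedCategory (Rep.{max u w} R G) (fun H : F.carrier => permutationModule R H.1)

/-- The condition that a contravariant functor from the Hecke category to `R`-modules is
`R`-linear on morphisms. -/
def isHeckeModule (R : Type w) [CommRing R] (F : FiniteSubgroupFamily G) :
    ObjectProperty ((HeckeCategory R F)ᵒᵖ ⥤ ModuleCat.{max u w} R) := fun M =>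
  (∀ (X Y : HeckeCategory R F) (f g : X ⟶ Y), M.map (f + g).op = M.map f.op + M.map g.op) ∧
    ∀ (X Y : HeckeCategory R F) (r : R) (f : X ⟶ Y), M.map (r • f).op = r • M.map f.op

/-- The category of (contravariant) `𝓗_F`-modules over `R`, with natural transformations as
morphisms. -/
abbrev HeckeModule (R : Type w) [CommRing R] (F : FiniteSubgroupFamily G) :=
  (isHeckeModule R F).FullSubcategory

namespace HeckeModule

variable {R : Type w} [CommRing R] {F : FiniteSubgroupFamily G}

/-- The value `M(G/H)` of an `𝓗_F`-module. -/
abbrev value (M : HeckeModule R F) (X : HeckeCategory R F) : ModuleCat.{max u w} R :=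
  M.obj.obj (op X)

/-- The component `M(G/H) → N(G/H)` of a morphism of `𝓗_F`-modules. -/
abbrev component {M N : HeckeModule R F} (f : M ⟶ N) (X : HeckeCategory R F) :
    M.value X →ₗ[R] N.value X :=
  (f.hom.app (op X)).hom

/-- The functor underlying the free module on a family of objects `x i`: the direct sum
`⨁ i, R[-, x i]` of representable functors (computed objectwise). -/
def freeFunctor {ι : Type (max u w)} (x : ι → HeckeCategory R F) :
    (HeckeCategory R F)ᵒᵖ ⥤ ModuleCat.{max u w} R :=
  ∐ fun i => (linearYoneda R (HeckeCategory R F)).obj (x i)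

/-- An `𝓗_F`-module is projective if it is a direct summand of a free module. -/
def IsProjective (M : HeckeModule R F) : Prop :=
  ∃ (ι : Type (max u w)) (x : ι → HeckeCategory R F), Nonempty (Retract M.obj (freeFunctor x))

/-- An `𝓗_F`-module is finitely generated if it is a quotient of a free module on a finite
family. -/
def IsFinitelyGenerated (M : HeckeModule R F) : Prop :=
  ∃ (ι : Type (max u w)) (_ : Finite ι) (x : ι → HeckeCategory R F) (f : freeFunctor x ⟶ M.obj),
    ∀ X, Function.Surjective (f.app X).hom

/-- The fixed point functor `V^-` of an `RG`-module `V`. Its value at `G/H` is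
`Hom_{RG}(R[G/H], V)`, identified with `V^H` by evaluation at the coset `H`, and the Hecke category
acts by precomposition. -/
def fixedPoint (F : FiniteSubgroupFamily G) {V : Type w} [AddCommGroup V] [Module R V]
    (ρ : Representation R G V) : HeckeModule R F where
  obj :=
    { obj := fun X => ModuleCat.of R
        ((Representation.ofMulAction R G (G ⧸ X.unop.1)).IntertwiningMap ρ)
      map := fun f => ModuleCat.ofHom
        { toFun := fun v => v.comp f.unop.hom.hom
          map_add' := fun v v' => Representation.IntertwiningMap.comp_add _ _ _ v v' _
          map_smul' := fun r v => Representation.IntertwiningMap.smul_comp _ _ _ r v _ }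
      map_id := fun X => by ext; rfl
      map_comp := fun f g => by ext; rfl }
  property := by
    refine ⟨fun X Y f g => ?_, fun X Y r f => ?_⟩
    · refine ModuleCat.hom_ext (LinearMap.ext fun v => ?_)
      exact Representation.IntertwiningMap.add_comp _ _ _ v f.hom.hom g.hom.hom
    · refine ModuleCat.hom_ext (LinearMap.ext fun v => ?_)
      exact Representation.IntertwiningMap.comp_smul _ _ _ r v f.hom.hom

/-- The `𝓗_F`-module `R^-`, the fixed point functor of `R` with trivial `G`-action. -/
def unit (R : Type w) [CommRing R] (F : FiniteSubgroupFamily G) : HeckeModule R F :=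
  fixedPoint F (Representation.trivial R G R)

/-- A projective resolution `⋯ → P₁ → P₀ → M → 0` of an `𝓗_F`-module; exactness is objectwise. -/
structure ProjRes (M : HeckeModule R F) where
  X : ℕ → HeckeModule R F
  projective : ∀ i, IsProjective (X i)
  d : ∀ i, X (i + 1) ⟶ X i
  aug : X 0 ⟶ M
  surjective_aug : ∀ Y, Function.Surjective (component aug Y)
  exact_zero : ∀ Y, Function.Exact (component (d 0) Y) (component aug Y)
  exact_succ : ∀ i Y, Function.Exact (component (d (i + 1)) Y) (component (d i) Y)

/-- The resolution has length at most `n`: all terms in degrees above `n` vanish. -/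
def ProjRes.LengthLE {M : HeckeModule R F} (P : ProjRes M) (n : ℕ∞) : Prop :=
  ∀ i : ℕ, n < i → ∀ Y, Subsingleton ((P.X i).value Y)

/-- The resolution is finitely generated up to degree `n` (in all degrees when `n = ∞`). -/
def ProjRes.FinitelyGeneratedUpTo {M : HeckeModule R F} (P : ProjRes M) (n : ℕ∞) : Prop :=
  ∀ i : ℕ, (i : ℕ∞) ≤ n → IsFinitelyGenerated (P.X i)

end HeckeModule

/-- The Hecke cohomological dimension `𝓗_F cd_R G`: the length of the shortest projective resolution
of `R^-` by `𝓗_F`-modules, with value `∞` if there is none of finite length. -/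
def heckeCd (R : Type w) [CommRing R] (F : FiniteSubgroupFamily G) : ℕ∞ :=
  sInf {n | ∃ P : HeckeModule.ProjRes (HeckeModule.unit R F), P.LengthLE n}

/-- `G` is `𝓗_F FP_n` over `R`: there is a projective resolution of `R^-` by `𝓗_F`-modules that is
finitely generated up to degree `n`. -/
def IsHeckeFP (R : Type w) [CommRing R] (F : FiniteSubgroupFamily G) (n : ℕ∞) : Prop :=
  ∃ P : HeckeModule.ProjRes (HeckeModule.unit R F), P.FinitelyGeneratedUpTo n

end

instance isPrime_span_natCast (q : ℕ) [hq : Fact q.Prime] :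
    (Ideal.span {(q : ℤ)}).IsPrime :=
  (Ideal.span_singleton_prime (by exact_mod_cast hq.out.ne_zero)).2
    (Nat.prime_iff_prime_int.1 hq.out)

/-- The localization `ℤ_(q)` of the integers at a prime `q`. -/
abbrev IntLocalizedAt (q : ℕ) [Fact q.Prime] : Type :=
  Localization.AtPrime (Ideal.span {(q : ℤ)})

/-!
Passing from the family `F` to its subfamily `P` does not change Hecke modules up to equivalence, and
the equivalence by restriction matches the two notions of projective resolution of `R^-`.

The arithmetic input is a transfer argument. For `K ≤ H` with `H` finite, the composite
`R[G/H] → R[G/K] → R[G/H]` of transfer and projection is multiplication by the index of `K` in `H`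
(`Representation.permutationMap_comp_transferMap`). If the indices of the members of `P` contained
in `H` generate the unit ideal of `R`, a linear combination of such composites is the identity, so
`R[G/H]` is a direct summand of a finite direct sum of modules `R[G/K]` with `K ∈ P`. The hypothesis
holds for the rings in question by Sylow's theorem: over `𝔽_q` and `ℤ_(q)` the index of a Sylow
`q`-subgroup is a unit, and over `ℤ` the indices of the Sylow `p`-subgroups, for all primes `p`, have
no common prime divisor.

Thus `P` generates `𝓗_F` (`HeckeCategory.Generates`): the identity of each object is a finite sum
`∑ k, a k ≫ b k` of endomorphisms factoring through `𝓗_P`. Consequently restriction of linear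
functors along `𝓗_P ⥤ 𝓗_F` is fully faithful (`HeckeModule.natTrans_ext_of_generates`,
`HeckeModule.exists_natTrans_of_generates`), and exactness, surjectivity and vanishing may be tested
on `𝓗_P`. Restriction preserves projective and finitely generated modules since representables
restrict to direct summands of finite sums of representables. Conversely, a projective `𝓗_P`-module
is the image of an idempotent of a free module; the free module and the idempotent extend to `𝓗_F`,
and splitting the extended idempotent extends the projective module
(`HeckeModule.exists_projective_extension`). So resolutions can be moved in both directions, term by
term.
-/

noncomputable section

variable {G : Type u} [Group G] {R : Type w} [CommRing R] {F P : FiniteSubgroupFamily G}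

/-! ### Generating subfamilies -/

namespace HeckeCategory

/-- The inclusion `𝓗_P ⥤ 𝓗_F` of Hecke categories for a subfamily `P ⊆ F`. -/
def inclusion (R : Type w) [CommRing R] (h : P.carrier ⊆ F.carrier) :
    HeckeCategory R P ⥤ HeckeCategory R F where
  obj X := ⟨X.1, h X.2⟩
  map f := ⟨f.hom⟩

/-- A morphism of `𝓗_F` between objects of the subfamily, regarded as a morphism of `𝓗_P`. -/
def restrictHom (h : P.carrier ⊆ F.carrier) {X Y : HeckeCategory R P}
    (f : (inclusion R h).obj X ⟶ (inclusion R h).obj Y) : X ⟶ Y :=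
  ⟨f.hom⟩

@[simp]
lemma inclusion_map_restrictHom (h : P.carrier ⊆ F.carrier) {X Y : HeckeCategory R P}
    (f : (inclusion R h).obj X ⟶ (inclusion R h).obj Y) :
    (inclusion R h).map (restrictHom h f) = f := rfl

/-- The subfamily `P` generates `𝓗_F`: the identity of every object of `𝓗_F` is a finite sum of
endomorphisms factoring through objects of `𝓗_P`. Equivalently, every `R[G/H]` with `H ∈ F` is a
direct summand of a finite direct sum of modules `R[G/K]` with `K ∈ P`. -/
def Generates (R : Type w) [CommRing R] (h : P.carrier ⊆ F.carrier) : Prop :=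
  ∀ X : HeckeCategory R F, ∃ (n : ℕ) (Y : Fin n → HeckeCategory R P)
    (a : ∀ k, X ⟶ (inclusion R h).obj (Y k)) (b : ∀ k, (inclusion R h).obj (Y k) ⟶ X),
    ∑ k, a k ≫ b k = 𝟙 X

end HeckeCategory

namespace HeckeModule

open HeckeCategory

lemma map_op_sum {M : (HeckeCategory R F)ᵒᵖ ⥤ ModuleCat.{max u w} R}
    (hM : isHeckeModule R F M) {X Y : HeckeCategory R F} {ι : Type*} (s : Finset ι)
    (f : ι → (X ⟶ Y)) : M.map (∑ k ∈ s, f k).op = ∑ k ∈ s, M.map (f k).op :=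
  _root_.map_sum (AddMonoidHom.mk' (fun g : X ⟶ Y => M.map g.op) (hM.1 X Y)) f s

/-! ### Extending natural transformations along a generating inclusion -/

section Extension

variable {h : P.carrier ⊆ F.carrier} {M N : (HeckeCategory R F)ᵒᵖ ⥤ ModuleCat.{max u w} R}

lemma sum_map_comp (hM : isHeckeModule R F M) {X : HeckeCategory R F} {n : ℕ}
    {Y : Fin n → HeckeCategory R P} {a : ∀ k, X ⟶ (inclusion R h).obj (Y k)}
    {b : ∀ k, (inclusion R h).obj (Y k) ⟶ X} (hab : ∑ k, a k ≫ b k = 𝟙 X) :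
    ∑ k, M.map (b k).op ≫ M.map (a k).op = 𝟙 (M.obj (op X)) := by
  have := map_op_sum hM Finset.univ (fun k => a k ≫ b k)
  rw [hab] at this
  simpa using this.symm

/-- Every element of a linear functor on `𝓗_F` is recovered from its restrictions to objects of a
generating subfamily. -/
lemma sum_map_apply (hM : isHeckeModule R F M) {X : HeckeCategory R F} {n : ℕ}
    {Y : Fin n → HeckeCategory R P} {a : ∀ k, X ⟶ (inclusion R h).obj (Y k)}
    {b : ∀ k, (inclusion R h).obj (Y k) ⟶ X} (hab : ∑ k, a k ≫ b k = 𝟙 X) (m : M.obj (op X)) :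
    ∑ k, (M.map (a k).op).hom ((M.map (b k).op).hom m) = m := by
  have := congr($(sum_map_comp hM hab).hom m)
  simpa [ModuleCat.hom_sum, LinearMap.sum_apply] using this

/-- A natural transformation to a linear functor on `𝓗_F` is determined by its restriction to a
generating subfamily. -/
lemma natTrans_ext_of_generates (hg : Generates R h) (hN : isHeckeModule R F N) {f f' : M ⟶ N}
    (H : Functor.whiskerLeft (inclusion R h).op f = Functor.whiskerLeft (inclusion R h).op f') :
    f = f' := by
  ext X : 2
  obtain ⟨n, Y, a, b, hab⟩ := hg X.unop
  have key : ∀ k, f.app (op ((inclusion R h).obj (Y k))) = f'.app (op ((inclusion R h).obj (Y k))) :=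
    fun k => congr($(H).app (op (Y k)))
  change f.app (op X.unop) = f'.app (op X.unop)
  rw [← Category.comp_id (f.app _), ← Category.comp_id (f'.app _), ← sum_map_comp hN hab]
  simp only [Preadditive.comp_sum, ← NatTrans.naturality_assoc, key]

/-- A natural transformation between the restrictions of two linear functors on `𝓗_F` to a
generating subfamily extends to `𝓗_F`: its component at `X` is forced to be
`∑ k, M(b k) ≫ f ≫ N(a k)` for any factorization `∑ k, a k ≫ b k = 𝟙 X`. -/
lemma exists_natTrans_of_generates (hg : Generates R h) (hM : isHeckeModule R F M)
    (hN : isHeckeModule R F N) (f : (inclusion R h).op ⋙ M ⟶ (inclusion R h).op ⋙ N) :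
    ∃ f' : M ⟶ N, Functor.whiskerLeft (inclusion R h).op f' = f := by
  choose n Y a b hab using hg
  have nat {Z Z' : HeckeCategory R P} (g : (inclusion R h).obj Z ⟶ (inclusion R h).obj Z') :
      M.map g.op ≫ f.app (op Z) = f.app (op Z') ≫ N.map g.op :=
    f.naturality (restrictHom h g).op
  have main {X X' : HeckeCategory R F} (g : X ⟶ X') :
      M.map g.op ≫ ∑ k, M.map (b X k).op ≫ f.app (op (Y X k)) ≫ N.map (a X k).op =
        (∑ k, M.map (b X' k).op ≫ f.app (op (Y X' k)) ≫ N.map (a X' k).op) ≫ N.map g.op := by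
    -- Both sides equal the double sum over the factorizations of `𝟙 X` and `𝟙 X'`.
    have e₁ : M.map g.op = ∑ l, M.map (b X' l).op ≫ M.map (g ≫ a X' l).op := by
      conv_lhs => rw [← Category.id_comp (M.map g.op), ← sum_map_comp hM (hab X')]
      simp [Preadditive.sum_comp]
    have e₂ : N.map g.op = ∑ k, N.map (b X k ≫ g).op ≫ N.map (a X k).op := by
      conv_lhs => rw [← Category.comp_id (N.map g.op), ← sum_map_comp hN (hab X)]
      simp [Preadditive.comp_sum]
    rw [e₁, e₂]
    simp only [Preadditive.sum_comp, Preadditive.comp_sum, Category.assoc]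
    refine Finset.sum_congr rfl fun k _ => Finset.sum_congr rfl fun l _ => ?_
    have := nat (b X k ≫ g ≫ a X' l)
    simp only [op_comp, Functor.map_comp, Category.assoc] at this ⊢
    rw [reassoc_of% this]
  refine ⟨{ app := fun X => ∑ k, M.map (b X.unop k).op ≫ f.app (op (Y X.unop k)) ≫
              N.map (a X.unop k).op
            naturality := fun X X' g => main g.unop }, ?_⟩
  ext Z : 2
  change ∑ k, M.map (b _ k).op ≫ f.app (op (Y _ k)) ≫ N.map (a _ k).op = f.app (op Z.unop)
  simp only [← nat, ← Category.assoc, ← Preadditive.sum_comp]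
  rw [sum_map_comp hM (hab _)]
  exact Category.id_comp _

end Extension

/-! ### Free modules and restriction to a subfamily -/

lemma isHeckeModule_of_retract {M N : (HeckeCategory R F)ᵒᵖ ⥤ ModuleCat.{max u w} R}
    (ρ : Retract M N) (hN : isHeckeModule R F N) : isHeckeModule R F M := by
  have key {X Y : HeckeCategory R F} (f : X ⟶ Y) :
      M.map f.op = ρ.i.app _ ≫ N.map f.op ≫ ρ.r.app _ := by
    rw [← ρ.i.naturality_assoc, ← NatTrans.comp_app, ρ.retract, NatTrans.id_app, Category.comp_id]
  refine ⟨fun X Y f g => ?_, fun X Y r f => ?_⟩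
  · simp only [key, hN.1, Preadditive.add_comp, Preadditive.comp_add]
  · simp only [key, hN.2, Linear.smul_comp, Linear.comp_smul]

section FreeFunctor

variable {ι : Type (max u w)} (x : ι → HeckeCategory R F)

/-- The inclusion of a summand into a free module. -/
def freeι (i : ι) : (linearYoneda R (HeckeCategory R F)).obj (x i) ⟶ freeFunctor x :=
  Sigma.ι (fun i => (linearYoneda R (HeckeCategory R F)).obj (x i)) i

/-- The morphism from a free module given by morphisms from its summands. -/
def freeDesc {M : (HeckeCategory R F)ᵒᵖ ⥤ ModuleCat.{max u w} R}
    (f : ∀ i, (linearYoneda R (HeckeCategory R F)).obj (x i) ⟶ M) : freeFunctor x ⟶ M :=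
  Sigma.desc f

lemma freeι_freeDesc {M : (HeckeCategory R F)ᵒᵖ ⥤ ModuleCat.{max u w} R}
    (f : ∀ i, (linearYoneda R (HeckeCategory R F)).obj (x i) ⟶ M) (i : ι) :
    freeι x i ≫ freeDesc x f = f i :=
  Sigma.ι_desc _ _

lemma freeι_freeDesc_assoc {M N : (HeckeCategory R F)ᵒᵖ ⥤ ModuleCat.{max u w} R}
    (f : ∀ i, (linearYoneda R (HeckeCategory R F)).obj (x i) ⟶ M) (i : ι) (g : M ⟶ N) :
    freeι x i ≫ freeDesc x f ≫ g = f i ≫ g := by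
  rw [← Category.assoc, freeι_freeDesc]

lemma freeFunctor_hom_ext {M : (HeckeCategory R F)ᵒᵖ ⥤ ModuleCat.{max u w} R}
    {f g : freeFunctor x ⟶ M} (H : ∀ i, freeι x i ≫ f = freeι x i ≫ g) : f = g :=
  Sigma.hom_ext _ _ H

lemma freeFunctor_hom_ext_app {X : (HeckeCategory R F)ᵒᵖ} {A : ModuleCat.{max u w} R}
    {f g : (freeFunctor x).obj X ⟶ A}
    (H : ∀ i, (freeι x i).app X ≫ f = (freeι x i).app X ≫ g) : f = g := by
  refine (isColimitOfPreserves ((evaluation _ _).obj X)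
    (coproductIsCoproduct fun i => (linearYoneda R (HeckeCategory R F)).obj (x i))).hom_ext ?_
  rintro ⟨i⟩
  exact H i

lemma isHeckeModule_freeFunctor : isHeckeModule R F (freeFunctor x) := by
  refine ⟨fun X Y f g => freeFunctor_hom_ext_app x fun i => ?_,
    fun X Y r f => freeFunctor_hom_ext_app x fun i => ?_⟩
  · rw [Preadditive.comp_add, ← NatTrans.naturality, ← NatTrans.naturality, ← NatTrans.naturality,
      ← Preadditive.add_comp]
    congr 1
    ext v
    exact Preadditive.add_comp _ _ _ f g v
  · rw [Linear.comp_smul, ← NatTrans.naturality, ← NatTrans.naturality, ← Linear.smul_comp]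
    congr 1
    ext v
    exact Linear.smul_comp _ _ _ r f v

end FreeFunctor

variable (h : P.carrier ⊆ F.carrier)

variable (R) in
/-- Restriction of functors from `𝓗_F` to `𝓗_P`. -/
abbrev restrictFunctor : ((HeckeCategory R F)ᵒᵖ ⥤ ModuleCat.{max u w} R) ⥤
    ((HeckeCategory R P)ᵒᵖ ⥤ ModuleCat.{max u w} R) :=
  (Functor.whiskeringLeft _ _ _).obj (inclusion R h).op

/-- Restriction of `𝓗_F`-modules to a subfamily. -/
abbrev restrict (M : HeckeModule R F) : HeckeModule R P where
  obj := (restrictFunctor R h).obj M.obj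
  property := ⟨fun _ _ f g => M.property.1 _ _ ((inclusion R h).map f) ((inclusion R h).map g),
    fun _ _ r f => M.property.2 _ _ r ((inclusion R h).map f)⟩

/-- A representable functor on an object of the subfamily restricts to a representable functor. -/
def restrictRepresentable (Y : HeckeCategory R P) :
    (restrictFunctor R h).obj ((linearYoneda R _).obj ((inclusion R h).obj Y)) ≅
      (linearYoneda R _).obj Y :=
  NatIso.ofComponents (fun _ => LinearEquiv.toModuleIso
    { toFun := fun f => restrictHom h f
      invFun := fun f => (inclusion R h).map f
      map_add' := fun _ _ => rfl
      map_smul' := fun _ _ => rfl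
      left_inv := fun _ => rfl
      right_inv := fun _ => rfl }) fun _ => rfl

/-- A free module on objects of the subfamily restricts to the free module on these objects. -/
def restrictFree {ι : Type (max u w)} (y : ι → HeckeCategory R P) :
    (restrictFunctor R h).obj (freeFunctor fun i => (inclusion R h).obj (y i)) ≅ freeFunctor y :=
  PreservesCoproduct.iso (restrictFunctor R h) _ ≪≫
    Sigma.mapIso fun i => restrictRepresentable h (y i)

variable {h}

/-- A free `𝓗_F`-module is a direct summand of a free module on objects of a generating
subfamily. -/
lemma exists_retract_freeFunctor (hg : Generates R h) {ι : Type (max u w)}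
    (x : ι → HeckeCategory R F) : ∃ (n : ι → ℕ) (y : (Σ i, Fin (n i)) → HeckeCategory R P),
      Nonempty (Retract (freeFunctor x) (freeFunctor fun p => (inclusion R h).obj (y p))) := by
  choose n Y a b hab using fun i => hg (x i)
  refine ⟨n, fun p => Y p.1 p.2, ⟨?_⟩⟩
  have hid (i : ι) : ∑ k, (linearYoneda R _).map (a i k) ≫ (linearYoneda R _).map (b i k) =
      𝟙 ((linearYoneda R (HeckeCategory R F)).obj (x i)) := by
    simp only [← Functor.map_comp]
    rw [← (linearYoneda R _).map_id, ← hab]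
    ext X f
    rw [NatTrans.app_sum, ModuleCat.hom_sum, LinearMap.sum_apply]
    exact (Preadditive.comp_sum _ _ _).symm
  exact
    { i := freeDesc x fun i => ∑ k, (linearYoneda R _).map (a i k) ≫
        freeι (fun p : Σ i, Fin (n i) => (inclusion R h).obj (Y p.1 p.2)) ⟨i, k⟩
      r := freeDesc _ fun p => (linearYoneda R _).map (b p.1 p.2) ≫ freeι x p.1
      retract := freeFunctor_hom_ext x fun i => by
        simp only [freeι_freeDesc_assoc, Preadditive.sum_comp, Category.assoc, freeι_freeDesc]
        simp only [← Category.assoc, ← Preadditive.sum_comp, hid]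
        simp }

lemma exists_retract_restrict_freeFunctor (hg : Generates R h) {ι : Type (max u w)}
    (x : ι → HeckeCategory R F) : ∃ (n : ι → ℕ) (y : (Σ i, Fin (n i)) → HeckeCategory R P),
      Nonempty (Retract ((restrictFunctor R h).obj (freeFunctor x)) (freeFunctor y)) := by
  obtain ⟨n, y, ⟨ρ⟩⟩ := exists_retract_freeFunctor hg x
  exact ⟨n, y, ⟨(ρ.map (restrictFunctor R h)).trans (Retract.ofIso (restrictFree h y))⟩⟩

lemma isProjective_restrict (hg : Generates R h) {M : HeckeModule R F} (hM : IsProjective M) :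
    IsProjective (restrict h M) := by
  obtain ⟨ι, x, ⟨ρ⟩⟩ := hM
  obtain ⟨n, y, ⟨σ⟩⟩ := exists_retract_restrict_freeFunctor hg x
  exact ⟨_, y, ⟨(ρ.map (restrictFunctor R h)).trans σ⟩⟩

lemma surjective_app_of_retract {M N : (HeckeCategory R F)ᵒᵖ ⥤ ModuleCat.{max u w} R}
    (ρ : Retract M N) (X : (HeckeCategory R F)ᵒᵖ) : Function.Surjective (ρ.r.app X).hom := fun m =>
  ⟨(ρ.i.app X).hom m, congr(($(ρ.retract).app X).hom m)⟩

lemma isFinitelyGenerated_restrict (hg : Generates R h) {M : HeckeModule R F}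
    (hM : IsFinitelyGenerated M) : IsFinitelyGenerated (restrict h M) := by
  obtain ⟨ι, hι, x, f, hf⟩ := hM
  obtain ⟨n, y, ⟨σ⟩⟩ := exists_retract_restrict_freeFunctor hg x
  refine ⟨_, inferInstance, y, σ.r ≫ (restrictFunctor R h).map f, fun X => ?_⟩
  exact (hf _).comp (surjective_app_of_retract σ X)

/-! ### Extending modules from a generating subfamily -/

/-- Every projective `𝓗_P`-module extends to a projective `𝓗_F`-module: it is the image of an
idempotent of a free module, both of which extend, and idempotents of functors split. -/
lemma exists_projective_extension (hg : Generates R h) {N : HeckeModule R P}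
    (hN : IsProjective N) :
    ∃ M : HeckeModule R F, IsProjective M ∧ Nonempty (restrict h M ≅ N) := by
  obtain ⟨ι, y, ⟨ρ⟩⟩ := hN
  set A := freeFunctor fun i => (inclusion R h).obj (y i)
  have hA : isHeckeModule R F A := isHeckeModule_freeFunctor _
  let σ : Retract N.obj ((restrictFunctor R h).obj A) :=
    ρ.trans (Retract.ofIso (restrictFree h y).symm)
  obtain ⟨p, hp⟩ := exists_natTrans_of_generates hg hA hA (σ.r ≫ σ.i)
  replace hp : (restrictFunctor R h).map p = σ.r ≫ σ.i := hp
  have hpp : p ≫ p = p := by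
    refine natTrans_ext_of_generates hg hA ?_
    change (restrictFunctor R h).map (p ≫ p) = (restrictFunctor R h).map p
    rw [Functor.map_comp, hp]
    simp
  obtain ⟨M, i, e, hie, hei⟩ := IsIdempotentComplete.idempotents_split A p hpp
  let τ : Retract M A := ⟨i, e, hie⟩
  have hei' : (restrictFunctor R h).map e ≫ (restrictFunctor R h).map i = σ.r ≫ σ.i := by
    rw [← Functor.map_comp, hei, hp]
  have hie' : (restrictFunctor R h).map i ≫ (restrictFunctor R h).map e = 𝟙 _ := by
    rw [← Functor.map_comp, hie, CategoryTheory.Functor.map_id]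
  -- Both `M`, restricted, and `N` split the idempotent `σ.r ≫ σ.i`.
  let iso : (restrictFunctor R h).obj M ≅ N.obj :=
    { hom := (restrictFunctor R h).map i ≫ σ.r
      inv := σ.i ≫ (restrictFunctor R h).map e
      hom_inv_id := by
        rw [Category.assoc, ← Category.assoc σ.r, ← hei', Category.assoc, hie', Category.comp_id,
          hie']
      inv_hom_id := by
        rw [Category.assoc, ← Category.assoc _ _ σ.r, hei', Category.assoc, σ.retract,
          Category.comp_id, σ.retract] }
  exact ⟨⟨M, isHeckeModule_of_retract τ hA⟩, ⟨ι, _, ⟨τ⟩⟩, ⟨ObjectProperty.isoMk _ iso⟩⟩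

lemma surjective_app_of_generates (hg : Generates R h)
    {M N : (HeckeCategory R F)ᵒᵖ ⥤ ModuleCat.{max u w} R} (hN : isHeckeModule R F N) (f : M ⟶ N)
    (H : ∀ Y : HeckeCategory R P,
      Function.Surjective (f.app (op ((inclusion R h).obj Y))).hom) (X : (HeckeCategory R F)ᵒᵖ) :
    Function.Surjective (f.app X).hom := by
  intro m
  obtain ⟨n, Y, a, b, hab⟩ := hg X.unop
  choose l hl using fun k => H (Y k) ((N.map (b k).op).hom m)
  refine ⟨∑ k, (M.map (a k).op).hom (l k), ?_⟩
  have nat (k) := congr($(f.naturality (a k).op).hom (l k))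
  simp only [ModuleCat.hom_comp, LinearMap.comp_apply] at nat
  rw [map_sum]
  refine Eq.trans (Finset.sum_congr rfl fun k _ => ?_) (sum_map_apply hN hab m)
  exact (nat k).trans (congrArg _ (hl k))

/-- Exactness at all objects of a generating subfamily implies exactness everywhere: each value of an
`𝓗_F`-module is naturally a direct summand of a finite sum of values on the subfamily. -/
lemma exact_component_of_generates (hg : Generates R h) {L M N : HeckeModule R F} (f : L ⟶ M)
    (g : M ⟶ N) (H : ∀ Y : HeckeCategory R P, Function.Exact
      (component f ((inclusion R h).obj Y)) (component g ((inclusion R h).obj Y)))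
    (X : HeckeCategory R F) : Function.Exact (component f X) (component g X) := by
  obtain ⟨n, Y, a, b, hab⟩ := hg X
  have natf (k l) : component f X ((L.obj.map (a k).op).hom l) =
      (M.obj.map (a k).op).hom (component f _ l) := congr($(f.hom.naturality (a k).op).hom l)
  have natg (k m) : component g _ ((M.obj.map (b k).op).hom m) =
      (N.obj.map (b k).op).hom (component g _ m) := congr($(g.hom.naturality (b k).op).hom m)
  have natf' (k l) : component f _ ((L.obj.map (b k).op).hom l) =
      (M.obj.map (b k).op).hom (component f _ l) := congr($(f.hom.naturality (b k).op).hom l)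
  refine fun m => ⟨fun hm => ?_, ?_⟩
  · choose l hl using fun k => (H (Y k) ((M.obj.map (b k).op).hom m)).1 (by rw [natg, hm, map_zero])
    refine ⟨∑ k, (L.obj.map (a k).op).hom (l k), ?_⟩
    rw [map_sum, ← sum_map_apply M.property hab m]
    exact Finset.sum_congr rfl fun k _ => (natf k _).trans (congrArg _ (hl k))
  · rintro ⟨l, rfl⟩
    rw [← sum_map_apply N.property hab (component g X _)]
    refine Finset.sum_eq_zero fun k _ => ?_
    rw [← natg, ← natf', (H (Y k)).apply_apply_eq_zero, map_zero]

lemma subsingleton_value_of_generates (hg : Generates R h) {M : HeckeModule R F}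
    (H : ∀ Y : HeckeCategory R P, Subsingleton (M.value ((inclusion R h).obj Y)))
    (X : HeckeCategory R F) : Subsingleton (M.value X) := by
  obtain ⟨n, Y, a, b, hab⟩ := hg X
  refine ⟨fun m m' => ?_⟩
  rw [← sum_map_apply M.property hab m, ← sum_map_apply M.property hab m']
  exact Finset.sum_congr rfl fun k _ => congrArg _ (Subsingleton.elim _ _)

lemma isFinitelyGenerated_of_restrict_iso (hg : Generates R h) {M : HeckeModule R F}
    {N : HeckeModule R P} (hN : IsFinitelyGenerated N) (e : restrict h M ≅ N) :
    IsFinitelyGenerated M := by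
  obtain ⟨ι, hι, y, f, hf⟩ := hN
  obtain ⟨f', hf'⟩ := exists_natTrans_of_generates hg
    (isHeckeModule_freeFunctor fun i => (inclusion R h).obj (y i)) M.property
    ((restrictFree h y).hom ≫ f ≫ e.inv.hom)
  refine ⟨ι, hι, _, f', surjective_app_of_generates hg M.property f' fun Y => ?_⟩
  have : f'.app (op ((inclusion R h).obj Y)) =
    ((restrictFree h y).app (op Y)).hom ≫ f.app (op Y) ≫
      (((isHeckeModule R P).ι.mapIso e).app (op Y)).inv := congr($(hf').app (op Y))
  rw [this]
  exact ((((isHeckeModule R P).ι.mapIso e).app (op Y)).symm.toLinearEquiv.surjective.comp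
    (hf _)).comp ((restrictFree h y).app (op Y)).toLinearEquiv.surjective

/-! ### Transporting resolutions -/

variable (R h) in
/-- The unit module restricts to the unit module. -/
def restrictUnit : restrict h (unit R F) ≅ unit R P :=
  ObjectProperty.isoMk _ (NatIso.ofComponents (fun _ => Iso.refl _) fun _ => rfl)

/-- Restriction to a generating subfamily carries projective resolutions of `R^-` to projective
resolutions of `R^-`, preserving vanishing and finite generation of the terms. -/
lemma ProjRes.exists_restrict (hg : Generates R h) (Q : ProjRes (unit R F)) :
    ∃ Q' : ProjRes (unit R P), ∀ n, (Q.LengthLE n → Q'.LengthLE n) ∧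
      (Q.FinitelyGeneratedUpTo n → Q'.FinitelyGeneratedUpTo n) :=
  ⟨{ X := fun i => restrict h (Q.X i)
     projective := fun i => isProjective_restrict hg (Q.projective i)
     d := fun i => ⟨(restrictFunctor R h).map (Q.d i).hom⟩
     aug := ⟨(restrictFunctor R h).map Q.aug.hom⟩
     surjective_aug := fun Y => Q.surjective_aug ((inclusion R h).obj Y)
     exact_zero := fun Y => Q.exact_zero ((inclusion R h).obj Y)
     exact_succ := fun i Y => Q.exact_succ i ((inclusion R h).obj Y) },
    fun _ => ⟨fun H i hi Y => H i hi ((inclusion R h).obj Y),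
      fun H i hi => isFinitelyGenerated_restrict hg (H i hi)⟩⟩

/-- The component of an isomorphism of modules, as a linear equivalence. -/
def componentEquiv {M N : HeckeModule R F} (e : M ≅ N) (X : HeckeCategory R F) :
    M.value X ≃ₗ[R] N.value X :=
  (((isHeckeModule R F).ι.mapIso e).app (op X)).toLinearEquiv

/-- Morphisms of `𝓗_P`-modules lift to given extensions of their source and target to `𝓗_F`. -/
lemma exists_hom_of_generates (hg : Generates R h) {M M' : HeckeModule R F} {N N' : HeckeModule R P}
    (e : restrict h M ≅ N) (e' : restrict h M' ≅ N') (f : N ⟶ N') :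
    ∃ f' : M ⟶ M', ∀ Y, component f Y ∘ₗ (componentEquiv e Y).toLinearMap =
      (componentEquiv e' Y).toLinearMap ∘ₗ component f' ((inclusion R h).obj Y) := by
  obtain ⟨f', hf'⟩ := exists_natTrans_of_generates hg M.property M'.property
    (e.hom.hom ≫ f.hom ≫ e'.inv.hom)
  refine ⟨⟨f'⟩, fun Y => ?_⟩
  have h₁ : ((restrictFunctor R h).map f').app (op Y) =
    e.hom.hom.app (op Y) ≫ f.hom.app (op Y) ≫ e'.inv.hom.app (op Y) := congr($(hf').app (op Y))
  have h₂ : e'.inv.hom.app (op Y) ≫ e'.hom.hom.app (op Y) = 𝟙 _ :=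
    congr(($(e'.inv_hom_id).hom).app (op Y))
  have h₃ : ((restrictFunctor R h).map f').app (op Y) ≫ e'.hom.hom.app (op Y) =
      e.hom.hom.app (op Y) ≫ f.hom.app (op Y) := by
    rw [h₁, Category.assoc, Category.assoc, h₂, Category.comp_id]
  exact congr(($h₃).hom).symm

/-- A projective resolution of `R^-` over a generating subfamily extends to `𝓗_F`, termwise and
without affecting vanishing or finite generation of the terms. -/
lemma ProjRes.exists_extension (hg : Generates R h) (Q : ProjRes (unit R P)) :
    ∃ Q' : ProjRes (unit R F), ∀ n, (Q.LengthLE n → Q'.LengthLE n) ∧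
      (Q.FinitelyGeneratedUpTo n → Q'.FinitelyGeneratedUpTo n) := by
  choose X hX e using fun i => exists_projective_extension hg (Q.projective i)
  replace e i := (e i).some
  choose d hd using fun i => exists_hom_of_generates hg (e (i + 1)) (e i) (Q.d i)
  obtain ⟨aug, haug⟩ := exists_hom_of_generates hg (e 0) (restrictUnit R h) Q.aug
  refine ⟨{ X := X, projective := hX, d := d, aug := aug, surjective_aug := ?_,
            exact_zero := ?_, exact_succ := ?_ }, fun n => ⟨fun H i hi => ?_, fun H i hi => ?_⟩⟩
  · refine fun Y => surjective_app_of_generates hg (unit R F).property aug.hom (fun Y => ?_) (op Y)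
    have : Function.Surjective (component Q.aug Y ∘ₗ (componentEquiv (e 0) Y).toLinearMap) :=
      (Q.surjective_aug Y).comp (componentEquiv (e 0) Y).surjective
    rw [haug] at this
    exact (Equiv.comp_surjective _ (componentEquiv (restrictUnit R h) Y).toEquiv).1 this
  · exact exact_component_of_generates hg _ _ fun Y =>
      (Function.Exact.iff_of_ladder_linearEquiv (hd 0 Y) (haug Y)).1 (Q.exact_zero Y)
  · exact fun i => exact_component_of_generates hg _ _ fun Y =>
      (Function.Exact.iff_of_ladder_linearEquiv (hd (i + 1) Y) (hd i Y)).1 (Q.exact_succ i Y)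
  · refine subsingleton_value_of_generates hg fun Y => ?_
    have := H i hi Y
    exact (componentEquiv (e i) Y).toEquiv.subsingleton
  · exact isFinitelyGenerated_of_restrict_iso hg (H i hi) (e i)

end HeckeModule

open HeckeCategory

/-! ### Invariance of dimension and finiteness properties -/

lemma heckeCd_eq_of_generates {h : P.carrier ⊆ F.carrier} (hg : Generates R h) :
    heckeCd R F = heckeCd R P := by
  refine congrArg sInf (Set.ext fun n => ⟨fun ⟨Q, hQ⟩ => ?_, fun ⟨Q, hQ⟩ => ?_⟩)
  · obtain ⟨Q', hQ'⟩ := Q.exists_restrict hg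
    exact ⟨Q', (hQ' n).1 hQ⟩
  · obtain ⟨Q', hQ'⟩ := Q.exists_extension hg
    exact ⟨Q', (hQ' n).1 hQ⟩

lemma isHeckeFP_iff_of_generates {h : P.carrier ⊆ F.carrier} (hg : Generates R h) (n : ℕ∞) :
    IsHeckeFP R F n ↔ IsHeckeFP R P n := by
  refine ⟨fun ⟨Q, hQ⟩ => ?_, fun ⟨Q, hQ⟩ => ?_⟩
  · obtain ⟨Q', hQ'⟩ := Q.exists_restrict hg
    exact ⟨Q', (hQ' n).2 hQ⟩
  · obtain ⟨Q', hQ'⟩ := Q.exists_extension hg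
    exact ⟨Q', (hQ' n).2 hQ⟩

/-! ### Transfer between permutation modules -/

namespace Representation

variable (R : Type w) [CommRing R] {X Y : Type*} [MulAction G X] [MulAction G Y]

/-- The `RG`-module homomorphism `R[X] → R[Y]` extending an equivariant map `X → R[Y]`. -/
def IntertwiningMap.ofEquivariant (f : X → MonoidAlgebra R Y)
    (hf : ∀ (g : G) x, f (g • x) = ofMulAction R G Y g (f x)) :
    (ofMulAction R G X).IntertwiningMap (ofMulAction R G Y) where
  toLinearMap := Finsupp.linearCombination R f ∘ₗ (MonoidAlgebra.coeffLinearEquiv R).toLinearMap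
  isIntertwining' g := by
    ext x
    simp [hf]

@[simp]
lemma IntertwiningMap.ofEquivariant_single (f : X → MonoidAlgebra R Y)
    (hf : ∀ (g : G) x, f (g • x) = ofMulAction R G Y g (f x)) (x : X) (r : R) :
    ofEquivariant R f hf (MonoidAlgebra.single x r) = r • f x := by
  change Finsupp.linearCombination R f (Finsupp.single x r) = _
  simp

variable {R} {π : X → Y}

/-- The map of permutation modules induced by a map of `G`-sets. -/
def permutationMap (hπ : ∀ (g : G) x, π (g • x) = g • π x) :
    (ofMulAction R G X).IntertwiningMap (ofMulAction R G Y) :=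
  .ofEquivariant R (fun x => MonoidAlgebra.single (π x) 1) fun g x => by simp [hπ]

/-- The transfer `R[Y] → R[X]` along a map `X → Y` of `G`-sets with finite fibres: a point of `Y` is
sent to the sum of the points of its fibre. -/
def transferMap (hπ : ∀ (g : G) x, π (g • x) = g • π x) (hfin : ∀ y, (π ⁻¹' {y}).Finite) :
    (ofMulAction R G Y).IntertwiningMap (ofMulAction R G X) :=
  .ofEquivariant R (fun y => ∑ x ∈ (hfin y).toFinset, MonoidAlgebra.single x 1) fun g y => by
    rw [map_sum]
    refine (Finset.sum_equiv (MulAction.toPerm g) (fun x => ?_) fun x _ => ?_).symm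
    · simp [hπ]
    · simp

/-- Transfer followed by projection is multiplication by the common size of the fibres. -/
lemma permutationMap_comp_transferMap (hπ : ∀ (g : G) x, π (g • x) = g • π x)
    (hfin : ∀ y, (π ⁻¹' {y}).Finite) {n : ℕ} (hn : ∀ y, (π ⁻¹' {y}).ncard = n) :
    (permutationMap hπ).comp (transferMap hπ hfin) =
      (n : R) • IntertwiningMap.id (ofMulAction R G Y) := by
  refine IntertwiningMap.ext (MonoidAlgebra.lhom_ext' fun y => LinearMap.ext_ring ?_)
  change permutationMap hπ (transferMap hπ hfin (MonoidAlgebra.single y (1 : R))) =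
    (n : R) • MonoidAlgebra.single y (1 : R)
  rw [transferMap, IntertwiningMap.ofEquivariant_single, one_smul, map_sum]
  simp only [permutationMap, IntertwiningMap.ofEquivariant_single, one_smul]
  have hsum : ∀ x ∈ (hfin y).toFinset, (MonoidAlgebra.single (π x) 1 : MonoidAlgebra R Y) =
      MonoidAlgebra.single y 1 := fun x hx => by
    rw [show π x = y by simpa using hx]
  rw [Finset.sum_congr rfl hsum, Finset.sum_const, ← Set.ncard_eq_toFinset_card _ (hfin y), hn,
    Nat.cast_smul_eq_nsmul]

end Representation

namespace Subgroup

variable {H K : Subgroup G}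

/-- The fibres of `G/K → G/H` for `K ≤ H` are in bijection with `H/K`. -/
def quotientMapOfLEFiberEquiv (h : K ≤ H) (y : G ⧸ H) :
    (quotientMapOfLE h ⁻¹' {y} : Set (G ⧸ K)) ≃ H ⧸ K.subgroupOf H :=
  ((quotientEquivProdOfLE h).subtypeEquiv (q := fun p => p.1 = y) fun x => by
    induction x using QuotientGroup.induction_on
    rfl).trans
    { toFun := fun p => p.1.2
      invFun := fun k => ⟨(y, k), rfl⟩
      left_inv := by rintro ⟨⟨_, k⟩, rfl⟩; rfl
      right_inv := fun _ => rfl }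

lemma ncard_fiber_quotientMapOfLE (h : K ≤ H) (y : G ⧸ H) :
    (quotientMapOfLE h ⁻¹' {y} : Set (G ⧸ K)).ncard = K.relIndex H :=
  Nat.card_congr (quotientMapOfLEFiberEquiv h y)

lemma finite_fiber_quotientMapOfLE [Finite H] (h : K ≤ H) (y : G ⧸ H) :
    (quotientMapOfLE h ⁻¹' {y} : Set (G ⧸ K)).Finite :=
  Finite.of_equiv _ (quotientMapOfLEFiberEquiv h y).symm

lemma quotientMapOfLE_smul (h : K ≤ H) (g : G) (x : G ⧸ K) :
    quotientMapOfLE h (g • x) = g • quotientMapOfLE h x := by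
  induction x using QuotientGroup.induction_on
  rfl

/-- A finite subgroup `H` has a `p`-subgroup of index prime to `p`. -/
lemma exists_isPGroup_not_dvd_relIndex (H : Subgroup G) [Finite H] (p : ℕ) [Fact p.Prime] :
    ∃ K ≤ H, IsPGroup p K ∧ ¬ p ∣ K.relIndex H := by
  obtain ⟨S⟩ : Nonempty (Sylow p H) := inferInstance
  refine ⟨S.map H.subtype, map_subtype_le _, S.isPGroup'.map _, ?_⟩
  rw [relIndex, subgroupOf, comap_map_eq_self_of_injective H.subtype_injective]
  exact S.not_dvd_index

end Subgroup

/-! ### Generation by subgroups of prime power order -/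

namespace HeckeCategory

variable {R : Type w} [CommRing R] {F P : FiniteSubgroupFamily G} {h : P.carrier ⊆ F.carrier}

/-- If, for each `H ∈ F`, the indices in `H` of the members of `P` contained in `H` generate the
unit ideal of `R`, then `P` generates `𝓗_F`: the endomorphism `R[G/H] → R[G/K] → R[G/H]` given by
transfer and projection is multiplication by the index of `K` in `H`. -/
lemma generates_of_span_relIndex_eq_top (H : ∀ H ∈ F.carrier,
    Ideal.span {x : R | ∃ K ∈ P.carrier, K ≤ H ∧ (K.relIndex H : R) = x} = ⊤) :
    Generates R h := by
  intro X
  have := F.finite_mem X.1 X.2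
  obtain ⟨n, c, x, hx⟩ := Submodule.mem_span_set'.1 ((Ideal.eq_top_iff_one _).1 (H X.1 X.2))
  choose K hK hKX hKx using fun k => (x k).2
  -- The coefficients of a relation `∑ k, c k * [X : K k] = 1` are absorbed into the transfers.
  let Y (k) : HeckeCategory R P := ⟨K k, hK k⟩
  have hπ k := Subgroup.quotientMapOfLE_smul (hKX k)
  have hfin k := Subgroup.finite_fiber_quotientMapOfLE (hKX k)
  let a (k) : X ⟶ (inclusion R h).obj (Y k) :=
    ⟨Rep.ofHom (Representation.transferMap (hπ k) (hfin k))⟩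
  let b (k) : (inclusion R h).obj (Y k) ⟶ X :=
    ⟨Rep.ofHom (Representation.permutationMap (hπ k))⟩
  have hab (k) : a k ≫ b k = (x k : R) • 𝟙 X := by
    refine InducedCategory.hom_ext (congrArg Rep.ofHom ?_)
    rw [← hKx]
    exact Representation.permutationMap_comp_transferMap (hπ k) (hfin k)
      (Subgroup.ncard_fiber_quotientMapOfLE (hKX k))
  refine ⟨n, Y, fun k => c k • a k, b, ?_⟩
  simp only [Linear.smul_comp, hab, smul_smul, ← Finset.sum_smul]
  rw [show ∑ k, c k * (x k : R) = 1 by simpa using hx, one_smul]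

end HeckeCategory

lemma Ideal.span_eq_top_of_forall_prime_exists_not_dvd {s : Set ℤ}
    (hs : ∀ p : ℕ, p.Prime → ∃ n : ℕ, ¬ p ∣ n ∧ (n : ℤ) ∈ s) : Ideal.span s = ⊤ := by
  obtain ⟨d, hd⟩ := IsPrincipalIdealRing.principal (Ideal.span s)
  replace hd : Ideal.span s = Ideal.span {d} := hd
  by_contra hne
  have hd1 : d.natAbs ≠ 1 := fun h1 =>
    hne (hd.trans (Ideal.span_singleton_eq_top.2 (Int.isUnit_iff_natAbs_eq.2 h1)))
  obtain ⟨p, hp, hpd⟩ := Nat.exists_prime_and_dvd hd1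
  obtain ⟨n, hpn, hn⟩ := hs p hp
  have : (n : ℤ) ∈ Ideal.span {d} := hd ▸ Ideal.subset_span hn
  refine hpn (hpd.trans ?_)
  simpa using Int.natAbs_dvd_natAbs.2 (Ideal.mem_span_singleton.1 this)

namespace FiniteSubgroupFamily

variable (F : FiniteSubgroupFamily G)

lemma primePowerSubgroups_subset : F.primePowerSubgroups.carrier ⊆ F.carrier := fun _ h => h.1

lemma pSubgroups_subset (q : ℕ) : (F.pSubgroups q).carrier ⊆ F.carrier := fun _ h => h.1

/-- Over `ℤ`, the indices of the Sylow subgroups of `H`, for all primes, have no common prime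
divisor. -/
lemma generates_primePowerSubgroups : Generates ℤ F.primePowerSubgroups_subset := by
  refine generates_of_span_relIndex_eq_top fun H hH =>
    Ideal.span_eq_top_of_forall_prime_exists_not_dvd fun p hp => ?_
  have := F.finite_mem H hH
  have := Fact.mk hp
  obtain ⟨K, hKH, hK, hpK⟩ := H.exists_isPGroup_not_dvd_relIndex p
  exact ⟨_, hpK, K, ⟨F.subgroup_mem H hH K hKH, p, hp, hK⟩, hKH, rfl⟩

/-- Over a ring in which integers prime to `q` are invertible, the index of a Sylow `q`-subgroup is
a unit. -/
lemma generates_pSubgroups (R : Type w) [CommRing R] (q : ℕ) [Fact q.Prime]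
    (hR : ∀ n : ℕ, ¬ q ∣ n → IsUnit (n : R)) : Generates R (F.pSubgroups_subset q) := by
  refine generates_of_span_relIndex_eq_top fun H hH => ?_
  have := F.finite_mem H hH
  obtain ⟨K, hKH, hK, hqK⟩ := H.exists_isPGroup_not_dvd_relIndex q
  exact Ideal.eq_top_of_isUnit_mem _ (Ideal.subset_span
    ⟨K, ⟨F.subgroup_mem H hH K hKH, hK⟩, hKH, rfl⟩) (hR _ hqK)

end FiniteSubgroupFamily

lemma ZMod.isUnit_natCast_of_not_dvd {q : ℕ} [Fact q.Prime] {n : ℕ} (hn : ¬ q ∣ n) :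
    IsUnit (n : ZMod q) :=
  isUnit_iff_ne_zero.2 (mt (ZMod.natCast_eq_zero_iff n q).1 hn)

lemma IntLocalizedAt.isUnit_natCast_of_not_dvd {q : ℕ} [Fact q.Prime] {n : ℕ} (hn : ¬ q ∣ n) :
    IsUnit (n : IntLocalizedAt q) := by
  have hn' : (n : ℤ) ∈ (Ideal.span {(q : ℤ)}).primeCompl := fun hmem =>
    hn (Int.natCast_dvd_natCast.1 (Ideal.mem_span_singleton.1 hmem))
  simpa using IsLocalization.map_units (IntLocalizedAt q) ⟨(n : ℤ), hn'⟩

end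

theorem mainTheorem4 {G : Type u} [Group G] (F : FiniteSubgroupFamily G) :
    (∀ n : ℕ∞,
      (heckeCd ℤ F = n ↔ heckeCd ℤ F.primePowerSubgroups = n) ∧
      (IsHeckeFP ℤ F n ↔ IsHeckeFP ℤ F.primePowerSubgroups n)) ∧
    ∀ (q : ℕ) [Fact q.Prime] (n : ℕ∞),
      ((heckeCd (ZMod q) F = n ↔ heckeCd (ZMod q) (F.pSubgroups q) = n) ∧
        (IsHeckeFP (ZMod q) F n ↔ IsHeckeFP (ZMod q) (F.pSubgroups q) n)) ∧
      ((heckeCd (IntLocalizedAt q) F = n ↔ heckeCd (IntLocalizedAt q) (F.pSubgroups q) = n) ∧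
        (IsHeckeFP (IntLocalizedAt q) F n ↔ IsHeckeFP (IntLocalizedAt q) (F.pSubgroups q) n)) := by
  refine ⟨fun n => ?_, fun q _ n => ?_⟩
  · have hg := F.generates_primePowerSubgroups
    exact ⟨by rw [heckeCd_eq_of_generates hg], isHeckeFP_iff_of_generates hg n⟩
  · have hg₁ := F.generates_pSubgroups (ZMod q) q fun _ => ZMod.isUnit_natCast_of_not_dvd
    have hg₂ := F.generates_pSubgroups (IntLocalizedAt q) q
      fun _ => IntLocalizedAt.isUnit_natCast_of_not_dvd
    exact ⟨⟨by rw [heckeCd_eq_of_generates hg₁], isHeckeFP_iff_of_generates hg₁ n⟩,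
      by rw [heckeCd_eq_of_generates hg₂], isHeckeFP_iff_of_generates hg₂ n⟩
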